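/- Let $\Gamma$ be a finite simple graph with vertex set $V$ and edge set $E$, and let $$G=\langle\, v\in V \mid v^2=1 \text{ for all } v\in V,\ [u,v]=1 \text{ whenever } \{u,v\}\in E\,\rangle$$ be the right-angled Coxeter group with defining graph $\Gamma$. For $l\ge 0$ let $b_l$ be the number of geodesic paths of length $l$ starting at the identity in the Cayley graph of $G$ with respect to the standard generating set $V$, and let $$\beta(G)=\limsup_{l\to\infty}\sqrt[l]{b_l}$$ be the geodesic exponential growth rate of $G$. If $G$ is infinite, then $\beta(G)$ is either $1$ or a Perron number, that is, a real algebraic integer greater than $1$ that is strictly greater in absolute value than each of its other Galois conjugates. -/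

import Mathlib

/-- The defining relators of the right-angled Coxeter group of `Γ`: the squares `v ^ 2` of the
vertices, and the commutators `u v u⁻¹ v⁻¹` of the pairs of adjacent vertices. -/
def racgRelators {V : Type*} (Γ : SimpleGraph V) : Set (FreeGroup V) :=
  {r | ∃ v : V, r = FreeGroup.of v ^ 2} ∪
    {r | ∃ u v : V, Γ.Adj u v ∧
      r = FreeGroup.of u * FreeGroup.of v * (FreeGroup.of u)⁻¹ * (FreeGroup.of v)⁻¹}

/-- The right-angled Coxeter group with defining graph `Γ`. -/
abbrev RACG {V : Type*} (Γ : SimpleGraph V) : Type _ := PresentedGroup (racgRelators Γ)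

/-- The standard generating set of the right-angled Coxeter group of `Γ`: the images of the
vertices. -/
def racgGenerators {V : Type*} (Γ : SimpleGraph V) : Set (RACG Γ) :=
  Set.range fun v : V => (PresentedGroup.of v : RACG Γ)

/-- The geodesic paths of length `l` in the Cayley graph of `G` with respect to `S` that start at
the identity: the walks with `l` edges from `1` to some `g` whose length is the distance from `1`
to `g`. (Two vertices `g ≠ h` of `SimpleGraph.mulCayley S` are adjacent if and only if
`g⁻¹ * h` lies in `S` or in `S⁻¹`.) -/
def geodesicsFromOne {G : Type*} [Group G] (S : Set G) (l : ℕ) :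
    Set (Σ g : G, (SimpleGraph.mulCayley S).Walk 1 g) :=
  {p | p.2.length = l ∧ p.2.length = (SimpleGraph.mulCayley S).dist 1 p.1}

/-- The geodesic exponential growth rate `limsup (b l) ^ (1 / l)` of `G` with respect to a finite
generating set `S`, where `b l` is the number of geodesic paths of length `l` that start at the
identity. (For finite `S` the sequence is bounded, by the cardinality of `S ∪ S⁻¹` or by `1`.) -/
noncomputable def geodesicGrowthRate {G : Type*} [Group G] (S : Set G) : ℝ :=
  Filter.limsup (fun l : ℕ => ((geodesicsFromOne S l).ncard : ℝ) ^ (1 / (l : ℝ))) Filter.atTop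

/-- A Perron number: a real algebraic integer bigger than `1` that is strictly greater in absolute
value than each of its other Galois conjugates. -/
def IsPerronNumber (x : ℝ) : Prop :=
  IsIntegral ℤ x ∧ 1 < x ∧ ∀ z : ℂ, IsConjRoot ℚ (x : ℂ) z → z ≠ (x : ℂ) → ‖z‖ < |x|

namespace RACG

variable {V : Type*} (Γ : SimpleGraph V)

lemma of_mul_self (v : V) :
    (PresentedGroup.of v : RACG Γ) * PresentedGroup.of v = 1 := by
  have h : (PresentedGroup.mk (racgRelators Γ)) (FreeGroup.of v ^ 2) = 1 :=
    PresentedGroup.one_of_mem (Or.inl ⟨v, rfl⟩)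
  rw [pow_two, map_mul] at h
  exact h

lemma of_inv (v : V) : (PresentedGroup.of v : RACG Γ)⁻¹ = PresentedGroup.of v :=
  inv_eq_of_mul_eq_one_left (of_mul_self Γ v)

variable {Γ} in
lemma of_mul_comm {u v : V} (huv : Γ.Adj u v) :
    (PresentedGroup.of u : RACG Γ) * PresentedGroup.of v =
      PresentedGroup.of v * PresentedGroup.of u := by
  have h : (PresentedGroup.mk (racgRelators Γ)) (FreeGroup.of u * FreeGroup.of v *
      (FreeGroup.of u)⁻¹ * (FreeGroup.of v)⁻¹) = 1 :=
    PresentedGroup.one_of_mem (Or.inr ⟨u, v, huv, rfl⟩)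
  rw [map_mul, map_mul, map_mul, map_inv, map_inv, mul_inv_eq_one, mul_inv_eq_iff_eq_mul] at h
  exact h

/-- The homomorphism out of a right-angled Coxeter group given by commuting involutions. -/
def lift {H : Type*} [Group H] (f : V → H) (hsq : ∀ v, f v * f v = 1)
    (hcomm : ∀ u v, Γ.Adj u v → f u * f v = f v * f u) : RACG Γ →* H :=
  PresentedGroup.toGroup (f := f) (by
    rintro r (⟨v, rfl⟩ | ⟨u, v, huv, rfl⟩)
    · simp [pow_two, hsq]
    · simp [hcomm u v huv])

@[simp]
lemma lift_of {H : Type*} [Group H] (f : V → H) (hsq : ∀ v, f v * f v = 1)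
    (hcomm : ∀ u v, Γ.Adj u v → f u * f v = f v * f u) (v : V) :
    lift Γ f hsq hcomm (PresentedGroup.of v) = f v :=
  PresentedGroup.toGroup.of _

/-- The element of the group that a word in the generators represents. -/
def wordProd (w : List V) : RACG Γ := (w.map PresentedGroup.of).prod

@[simp]
lemma wordProd_nil : wordProd Γ [] = 1 := rfl

@[simp]
lemma wordProd_cons (v : V) (w : List V) :
    wordProd Γ (v :: w) = PresentedGroup.of v * wordProd Γ w := by
  simp [wordProd]

@[simp]
lemma wordProd_append (w w' : List V) :
    wordProd Γ (w ++ w') = wordProd Γ w * wordProd Γ w' := by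
  simp [wordProd]

/-- The letter `v` can be put in front of the word `w` without creating a cancellation. -/
def Allows (v : V) : List V → Prop
  | [] => True
  | x :: w => x ≠ v ∧ (Γ.Adj x v → Allows v w)

/-- No two equal letters of the word can be brought together by commutations. -/
def Reduced : List V → Prop
  | [] => True
  | x :: w => Allows Γ x w ∧ Reduced w

variable {Γ}

lemma Allows.exists_not_adj {v : V} {q c : List V} (h : Allows Γ v (q ++ v :: c)) :
    ∃ u ∈ q, u ≠ v ∧ ¬ Γ.Adj u v := by
  induction q with
  | nil => exact absurd rfl h.1
  | cons x q ih =>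
    by_cases hx : Γ.Adj x v
    · obtain ⟨u, hu, h'⟩ := ih (h.2 hx)
      exact ⟨u, List.mem_cons_of_mem _ hu, h'⟩
    · exact ⟨x, List.mem_cons_self, h.1, hx⟩

lemma Allows.of_append {v : V} {q c : List V} (h : Allows Γ v (q ++ c)) : Allows Γ v q := by
  induction q with
  | nil => trivial
  | cons x q ih => exact ⟨h.1, fun hx => ih (h.2 hx)⟩

lemma Reduced.of_append {q c : List V} (h : Reduced Γ (q ++ c)) : Reduced Γ q := by
  induction q with
  | nil => trivial
  | cons x q ih => exact ⟨h.1.of_append, ih h.2⟩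

lemma exists_shorter_of_not_allows {v : V} {w : List V} (h : ¬ Allows Γ v w) :
    ∃ w', wordProd Γ w' = PresentedGroup.of v * wordProd Γ w ∧ w'.length + 1 = w.length := by
  induction w with
  | nil => exact absurd trivial h
  | cons x w ih =>
    by_cases hxv : x = v
    · exact ⟨w, by rw [hxv, wordProd_cons, ← mul_assoc, of_mul_self, one_mul], rfl⟩
    · have h' : Γ.Adj x v ∧ ¬ Allows Γ v w := by
        by_contra hcon
        exact h ⟨hxv, fun hx => by_contra fun hw => hcon ⟨hx, hw⟩⟩
      obtain ⟨w', hw', hlen⟩ := ih h'.2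
      refine ⟨x :: w', ?_, by simp [hlen]⟩
      rw [wordProd_cons, hw', wordProd_cons, ← mul_assoc, ← mul_assoc, of_mul_comm h'.1]

lemma exists_shorter_of_not_reduced {w : List V} (h : ¬ Reduced Γ w) :
    ∃ w', wordProd Γ w' = wordProd Γ w ∧ w'.length < w.length := by
  induction w with
  | nil => exact absurd trivial h
  | cons x w ih =>
    by_cases hx : Allows Γ x w
    · obtain ⟨w', hw', hlen⟩ := ih fun hw => h ⟨hx, hw⟩
      exact ⟨x :: w', by simp [hw'], by simpa using hlen⟩
    · obtain ⟨w', hw', hlen⟩ := exists_shorter_of_not_allows hx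
      exact ⟨w', by simp [hw'], by simp; omega⟩

variable (Γ)

/-- The subgroup generated by a vertex and its neighbours. -/
def starSubgroup (v : V) : Subgroup (RACG Γ) :=
  Subgroup.closure (PresentedGroup.of '' {u | u = v ∨ Γ.Adj u v})

/-- The walls of the group, each given by its type and a coset of the star subgroup. -/
abbrev Wall : Type _ := Σ v : V, RACG Γ ⧸ starSubgroup Γ v

/-- The wall that separates the identity from a generator. -/
def baseWall (v : V) : Wall Γ := ⟨v, ((1 : RACG Γ) : RACG Γ ⧸ starSubgroup Γ v)⟩

variable {Γ} in
lemma of_smul_baseWall {u v : V} (h : u = v ∨ Γ.Adj u v) :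
    (PresentedGroup.of u : RACG Γ) • baseWall Γ v = baseWall Γ v := by
  have hu : (PresentedGroup.of u : RACG Γ) ∈ starSubgroup Γ v :=
    Subgroup.subset_closure ⟨u, h, rfl⟩
  have h' : ((PresentedGroup.of u * 1 : RACG Γ) : RACG Γ ⧸ starSubgroup Γ v) = (1 : RACG Γ) := by
    rw [QuotientGroup.eq]
    simpa using hu
  exact congrArg (Sigma.mk v) h'

lemma smul_baseWall_eq_iff {g : RACG Γ} {u v : V} :
    g • baseWall Γ v = baseWall Γ u ↔ v = u ∧ g ∈ starSubgroup Γ v := by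
  constructor
  · intro h
    have huv : v = u := congrArg Sigma.fst h
    subst huv
    refine ⟨rfl, ?_⟩
    have h' : ((g * 1 : RACG Γ) : RACG Γ ⧸ starSubgroup Γ v) = (1 : RACG Γ) :=
      eq_of_heq (Sigma.mk.inj h).2
    rw [QuotientGroup.eq] at h'
    simpa using h'
  · rintro ⟨rfl, hg⟩
    have h' : ((g * 1 : RACG Γ) : RACG Γ ⧸ starSubgroup Γ v) = (1 : RACG Γ) := by
      rw [QuotientGroup.eq]
      simpa using hg
    exact congrArg (Sigma.mk v) h'

variable {Γ} in
lemma of_smul_eq_baseWall_iff {u v : V} (h : u = v ∨ Γ.Adj u v) (x : Wall Γ) :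
    (PresentedGroup.of u : RACG Γ) • x = baseWall Γ v ↔ x = baseWall Γ v := by
  rw [smul_eq_iff_eq_inv_smul, of_inv, of_smul_baseWall h]

open Classical in
/-- The indicator function of a base wall. -/
noncomputable def wallIndicator (s : V) (x : Wall Γ) : ZMod 2 := if x = baseWall Γ s then 1 else 0

variable {Γ} in
lemma wallIndicator_smul {u v : V} (h : u = v ∨ Γ.Adj u v) (x : Wall Γ) :
    wallIndicator Γ v ((PresentedGroup.of u : RACG Γ) • x) = wallIndicator Γ v x := by
  by_cases hx : x = baseWall Γ v
  · rw [wallIndicator, wallIndicator, if_pos hx, if_pos ((of_smul_eq_baseWall_iff h x).2 hx)]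
  · rw [wallIndicator, wallIndicator, if_neg hx, if_neg (mt (of_smul_eq_baseWall_iff h x).1 hx)]

/-- A generator acts on walls with a parity, which changes at the base wall of the generator. -/
noncomputable def crossing (s : V) (p : Wall Γ × ZMod 2) : Wall Γ × ZMod 2 :=
  ((PresentedGroup.of s : RACG Γ) • p.1, wallIndicator Γ s p.1 + p.2)

lemma crossing_crossing (s : V) (p : Wall Γ × ZMod 2) : crossing Γ s (crossing Γ s p) = p := by
  have h2 : ∀ e : ZMod 2, e + e = 0 := by decide
  refine Prod.ext ?_ ?_
  · simp only [crossing, smul_smul, of_mul_self, one_smul]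
  · simp only [crossing, wallIndicator_smul (Or.inl rfl : s = s ∨ Γ.Adj s s)]
    rw [← add_assoc, h2, zero_add]

variable {Γ} in
lemma crossing_comm {u v : V} (h : Γ.Adj u v) (p : Wall Γ × ZMod 2) :
    crossing Γ u (crossing Γ v p) = crossing Γ v (crossing Γ u p) := by
  refine Prod.ext ?_ ?_
  · simp only [crossing, smul_smul, of_mul_comm h]
  · simp only [crossing, wallIndicator_smul (Or.inr h), wallIndicator_smul (Or.inr h.symm)]
    rw [add_left_comm]

/-- The action of the group on walls with a parity. -/
noncomputable def crossingHom : RACG Γ →* Equiv.Perm (Wall Γ × ZMod 2) :=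
  lift Γ (fun s => Function.Involutive.toPerm (crossing Γ s) (crossing_crossing Γ s))
    (fun v => Equiv.ext fun p => crossing_crossing Γ v p)
    (fun _ _ h => Equiv.ext fun p => crossing_comm h p)

/-- The walls that a path labelled by the word crosses, seen from the end of the path. -/
def walls : List V → List (Wall Γ)
  | [] => []
  | s :: w => (wordProd Γ w)⁻¹ • baseWall Γ s :: walls w

@[simp]
lemma length_walls (w : List V) : (walls Γ w).length = w.length := by
  induction w with
  | nil => rfl
  | cons s w ih => simp [walls, ih]

open Classical in
lemma crossingHom_wordProd (w : List V) (x : Wall Γ) :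
    crossingHom Γ (wordProd Γ w) (x, 0) = (wordProd Γ w • x, ((walls Γ w).count x : ZMod 2)) := by
  induction w with
  | nil => simp [walls]
  | cons s w ih =>
    rw [wordProd_cons, map_mul, Equiv.Perm.mul_apply, ih]
    have : ∀ p, crossingHom Γ (PresentedGroup.of s) p = crossing Γ s p := fun p => by
      rw [crossingHom, lift_of]; rfl
    rw [this]
    refine Prod.ext ?_ ?_
    · simp [crossing, smul_smul]
    · simp only [crossing, walls, List.count_cons, beq_iff_eq, Nat.cast_add, Nat.cast_ite,
        Nat.cast_one, Nat.cast_zero]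
      rw [add_comm]
      refine congrArg _ (if_congr ?_ rfl rfl)
      rw [inv_smul_eq_iff, eq_comm]

lemma length_le_of_nodup_walls {w w' : List V} (hw : (walls Γ w).Nodup)
    (h : wordProd Γ w' = wordProd Γ w) : w.length ≤ w'.length := by
  classical
  rw [← length_walls Γ w, ← length_walls Γ w']
  refine (List.Nodup.subperm hw fun x hx => ?_).length_le
  by_contra hx'
  have h1 := congrArg Prod.snd (crossingHom_wordProd Γ w x)
  have h2 := congrArg Prod.snd (crossingHom_wordProd Γ w' x)
  rw [h, h1] at h2
  simp only [List.count_eq_one_of_mem hw hx, List.count_eq_zero_of_not_mem hx'] at h2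
  exact absurd h2 (by decide)

lemma exists_of_mem_walls {w : List V} {x : Wall Γ} (hx : x ∈ walls Γ w) :
    ∃ q v c, w = q ++ v :: c ∧ x = (wordProd Γ c)⁻¹ • baseWall Γ v := by
  induction w with
  | nil => simp [walls] at hx
  | cons s w ih =>
    rcases List.mem_cons.1 hx with rfl | hx
    · exact ⟨[], s, w, rfl, rfl⟩
    · obtain ⟨q, v, c, rfl, rfl⟩ := ih hx
      exact ⟨s :: q, v, c, rfl, rfl⟩

open Classical in
/-- The retraction onto the star subgroup. -/
noncomputable def starRetraction (v : V) : RACG Γ →* RACG Γ :=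
  lift Γ (fun u => if u = v ∨ Γ.Adj u v then PresentedGroup.of u else 1)
    (fun u => by split_ifs <;> simp [of_mul_self])
    (fun u w h => by split_ifs <;> simp [of_mul_comm h])

lemma starRetraction_eq_self {v : V} {g : RACG Γ} (hg : g ∈ starSubgroup Γ v) :
    starRetraction Γ v g = g := by
  have h : starSubgroup Γ v ≤ MonoidHom.eqLocus (starRetraction Γ v) (MonoidHom.id _) := by
    refine (Subgroup.closure_le _).2 ?_
    rintro _ ⟨u, hu, rfl⟩
    change starRetraction Γ v (PresentedGroup.of u) = PresentedGroup.of u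
    rw [starRetraction, lift_of]
    exact if_pos hu
  exact h hg

open Classical in
lemma starRetraction_wordProd (v : V) (w : List V) :
    starRetraction Γ v (wordProd Γ w) = wordProd Γ (w.filter fun u => u = v ∨ Γ.Adj u v) := by
  induction w with
  | nil => simp
  | cons u w ih =>
    rw [wordProd_cons, map_mul, ih, starRetraction, lift_of]
    by_cases hu : u = v ∨ Γ.Adj u v
    · rw [List.filter_cons_of_pos (by simpa using hu), if_pos hu, wordProd_cons]
    · rw [List.filter_cons_of_neg (by simpa using hu), if_neg hu, one_mul]

variable {Γ}

theorem Reduced.length_le {w : List V} (hw : Reduced Γ w) :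
    ∀ w', wordProd Γ w' = wordProd Γ w → w.length ≤ w'.length := by
  classical
  have key : ∀ n, ∀ w : List V, w.length ≤ n → Reduced Γ w → (walls Γ w).Nodup := by
    intro n
    induction n with
    | zero =>
      intro w hn _
      rw [List.length_eq_zero_iff.1 (Nat.le_zero.1 hn)]
      exact List.nodup_nil
    | succ n ih =>
      rintro (_ | ⟨s, w⟩) hn hw
      · exact List.nodup_nil
      · have hwn : w.length ≤ n := by simpa using hn
        refine List.nodup_cons.2 ⟨fun hmem => ?_, ih w hwn hw.2⟩
        obtain ⟨q, v, c, rfl, hx⟩ := exists_of_mem_walls Γ hmem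
        rw [inv_smul_eq_iff, wordProd_append, wordProd_cons, mul_smul, mul_smul, smul_inv_smul,
          of_smul_baseWall (Or.inl rfl), eq_comm, smul_baseWall_eq_iff] at hx
        obtain ⟨rfl, hq⟩ := hx
        obtain ⟨u, hu, huv, hadj⟩ := hw.1.exists_not_adj
        have hr : wordProd Γ (q.filter fun u => u = v ∨ Γ.Adj u v) = wordProd Γ q := by
          rw [← starRetraction_wordProd, starRetraction_eq_self Γ hq]
        have hqn : q.length ≤ n := by
          simp only [List.length_append, List.length_cons] at hwn
          omega
        have hle := length_le_of_nodup_walls Γ (ih q hqn hw.2.of_append) hr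
        have hlt : (q.filter fun u => u = v ∨ Γ.Adj u v).length < q.length :=
          List.length_filter_lt_length_iff_exists.2 ⟨u, hu, by simp [huv, hadj]⟩
        omega
  exact fun w' h => length_le_of_nodup_walls Γ (key _ w le_rfl hw) h

lemma of_ne_one (v : V) : (PresentedGroup.of v : RACG Γ) ≠ 1 := by
  intro h
  have := Reduced.length_le (Γ := Γ) (w := [v]) ⟨trivial, trivial⟩ [] (by simp [h])
  simp at this

lemma of_injective : Function.Injective (PresentedGroup.of : V → RACG Γ) := by
  classical
  intro u v h
  by_contra huv
  let f : RACG Γ →* Multiplicative (ZMod 2) :=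
    lift Γ (fun x => if x = u then Multiplicative.ofAdd 1 else 1)
      (fun x => by split_ifs <;> decide) (fun _ _ _ => mul_comm _ _)
  have hf := congrArg f h
  simp only [f, lift_of, if_pos, if_neg (Ne.symm huv)] at hf
  exact absurd hf (by decide)

lemma cayley_adj_iff {g h : RACG Γ} :
    (SimpleGraph.mulCayley (racgGenerators Γ)).Adj g h ↔
      ∃ v : V, g * PresentedGroup.of v = h := by
  rw [SimpleGraph.mulCayley_adj']
  constructor
  · rintro ⟨-, _, ⟨v, rfl⟩, h | h⟩
    · exact ⟨v, h⟩
    · exact ⟨v, by simp only [h, mul_assoc, of_mul_self, mul_one]⟩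
  · rintro ⟨v, rfl⟩
    exact ⟨fun h => of_ne_one v (left_eq_mul.1 h), _, ⟨v, rfl⟩, Or.inl rfl⟩

/-- The word that labels a path in the Cayley graph. -/
noncomputable def label : ∀ {g h : RACG Γ},
    (SimpleGraph.mulCayley (racgGenerators Γ)).Walk g h → List V
  | _, _, .nil => []
  | _, _, .cons hadj p => (cayley_adj_iff.1 hadj).choose :: label p

lemma length_label {g h : RACG Γ} (p : (SimpleGraph.mulCayley (racgGenerators Γ)).Walk g h) :
    (label p).length = p.length := by
  induction p with
  | nil => rfl
  | cons hadj p ih => simp [label, ih]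

lemma mul_wordProd_label {g h : RACG Γ}
    (p : (SimpleGraph.mulCayley (racgGenerators Γ)).Walk g h) :
    g * wordProd Γ (label p) = h := by
  induction p with
  | nil => simp [label]
  | cons hadj p ih => rw [label, wordProd_cons, ← mul_assoc, (cayley_adj_iff.1 hadj).choose_spec, ih]

lemma sigma_eq_of_label_eq {g h h' : RACG Γ}
    (p : (SimpleGraph.mulCayley (racgGenerators Γ)).Walk g h)
    (p' : (SimpleGraph.mulCayley (racgGenerators Γ)).Walk g h') (hp : label p = label p') :
    (⟨h, p⟩ : Σ h, (SimpleGraph.mulCayley (racgGenerators Γ)).Walk g h) = ⟨h', p'⟩ := by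
  induction p with
  | nil =>
    cases p' with
    | nil => rfl
    | cons hadj p' => simp [label] at hp
  | @cons a b c hadj p ih =>
    cases p' with
    | nil => simp [label] at hp
    | @cons _ b' _ hadj' p' =>
      rw [label, label, List.cons.injEq] at hp
      have hb : b = b' := by
        rw [← (cayley_adj_iff.1 hadj).choose_spec, ← (cayley_adj_iff.1 hadj').choose_spec, hp.1]
      subst hb
      have := ih p' hp.2
      cases this
      rfl

lemma exists_label_eq (g : RACG Γ) (w : List V) :
    ∃ h, ∃ p : (SimpleGraph.mulCayley (racgGenerators Γ)).Walk g h, label p = w := by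
  induction w generalizing g with
  | nil => exact ⟨g, .nil, rfl⟩
  | cons v w ih =>
    obtain ⟨h, p, hp⟩ := ih (g * PresentedGroup.of v)
    have hadj : (SimpleGraph.mulCayley (racgGenerators Γ)).Adj g (g * PresentedGroup.of v) :=
      cayley_adj_iff.2 ⟨v, rfl⟩
    refine ⟨h, .cons hadj p, ?_⟩
    rw [label, hp]
    exact congrArg (· :: w) (of_injective (mul_left_cancel (cayley_adj_iff.1 hadj).choose_spec))

lemma length_eq_dist_iff {g : RACG Γ}
    (p : (SimpleGraph.mulCayley (racgGenerators Γ)).Walk 1 g) :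
    p.length = (SimpleGraph.mulCayley (racgGenerators Γ)).dist 1 g ↔ Reduced Γ (label p) := by
  have hp := mul_wordProd_label p
  rw [one_mul] at hp
  constructor
  · intro h
    by_contra hred
    obtain ⟨w, hw, hlen⟩ := exists_shorter_of_not_reduced hred
    obtain ⟨g', q, rfl⟩ := exists_label_eq (1 : RACG Γ) w
    have hq := mul_wordProd_label q
    rw [one_mul, hw, hp] at hq
    subst hq
    have := SimpleGraph.dist_le q
    rw [length_label, length_label] at hlen
    omega
  · intro h
    refine le_antisymm ?_ (SimpleGraph.dist_le p)
    obtain ⟨q, hq⟩ := SimpleGraph.Reachable.exists_walk_length_eq_dist ⟨p⟩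
    have hq' := mul_wordProd_label q
    rw [one_mul] at hq'
    rw [← hq, ← length_label, ← length_label]
    exact h.length_le _ (hq'.trans hp.symm)

variable (Γ) in
theorem ncard_geodesicsFromOne (l : ℕ) :
    (geodesicsFromOne (racgGenerators Γ) l).ncard =
      {w : List V | w.length = l ∧ Reduced Γ w}.ncard := by
  refine Set.ncard_congr (fun p _ => label p.2) ?_ ?_ ?_
  · rintro ⟨g, p⟩ ⟨hl, hd⟩
    exact ⟨(length_label p).trans hl, (length_eq_dist_iff p).1 hd⟩
  · rintro ⟨g, p⟩ ⟨g', p'⟩ - - h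
    exact sigma_eq_of_label_eq p p' h
  · rintro w ⟨hl, hred⟩
    obtain ⟨g, p, rfl⟩ := exists_label_eq (1 : RACG Γ) w
    exact ⟨⟨g, p⟩, ⟨(length_label p).symm.trans hl, (length_eq_dist_iff p).2 hred⟩, rfl⟩

lemma exists_reduced (g : RACG Γ) : ∃ w, Reduced Γ w ∧ wordProd Γ w = g := by
  have hex : ∃ w, wordProd Γ w = g := by
    have hg : g ∈ Subgroup.closure (Set.range (PresentedGroup.of : V → RACG Γ)) := by
      rw [PresentedGroup.closure_range_of]; trivial
    induction hg using Subgroup.closure_induction_left with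
    | one => exact ⟨[], rfl⟩
    | mul_left x hx y hy ih =>
      obtain ⟨v, rfl⟩ := hx
      obtain ⟨w, rfl⟩ := ih
      exact ⟨v :: w, wordProd_cons Γ v w⟩
    | inv_mul_cancel x hx y hy ih =>
      obtain ⟨v, rfl⟩ := hx
      obtain ⟨w, rfl⟩ := ih
      exact ⟨v :: w, by rw [wordProd_cons, of_inv]⟩
  obtain ⟨w, hw, hmin⟩ := (measure (List.length (α := V))).wf.has_min {w | wordProd Γ w = g} hex
  refine ⟨w, by_contra fun hred => ?_, hw⟩
  obtain ⟨w', hw', hlen⟩ := exists_shorter_of_not_reduced hred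
  exact hmin w' (hw'.trans hw) hlen

end RACG

namespace Matrix

variable {n : Type*} [Fintype n]

lemma mulVec_pos_of_pos {A : Matrix n n ℝ} (hA : ∀ i j, 0 < A i j) {x : n → ℝ}
    (hx : ∀ i, 0 ≤ x i) (hx0 : x ≠ 0) (i : n) : 0 < (A *ᵥ x) i := by
  obtain ⟨j, hj⟩ := Function.ne_iff.1 hx0
  exact Finset.sum_pos' (fun j _ => mul_nonneg (hA i j).le (hx j))
    ⟨j, Finset.mem_univ j, mul_pos (hA i j) (lt_of_le_of_ne (hx j) (Ne.symm hj))⟩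

lemma mulVec_nonneg_of_nonneg {A : Matrix n n ℝ} (hA : ∀ i j, 0 ≤ A i j) {x : n → ℝ}
    (hx : ∀ i, 0 ≤ x i) (i : n) : 0 ≤ (A *ᵥ x) i :=
  Finset.sum_nonneg fun j _ => mul_nonneg (hA i j) (hx j)

lemma le_sum_of_smul_le_mulVec {A : Matrix n n ℝ} (hA : ∀ i j, 0 ≤ A i j) {x : n → ℝ}
    (hx : x ∈ stdSimplex ℝ n) {t : ℝ} (ht : ∀ i, t * x i ≤ (A *ᵥ x) i) :
    t ≤ ∑ i, ∑ j, A i j := by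
  calc t = ∑ i, t * x i := by rw [← Finset.mul_sum, hx.2, mul_one]
    _ ≤ ∑ i, (A *ᵥ x) i := Finset.sum_le_sum fun i _ => ht i
    _ ≤ ∑ i, ∑ j, A i j := by
      refine Finset.sum_le_sum fun i _ => Finset.sum_le_sum fun j _ => ?_
      refine mul_le_of_le_one_right (hA i j) ?_
      rw [← hx.2]
      exact Finset.single_le_sum (fun j _ => hx.1 j) (Finset.mem_univ j)

lemma norm_eigenvalue_le {A : Matrix n n ℝ} (hA : ∀ i j, 0 ≤ A i j) {r : ℝ} {x : n → ℝ}
    (hx : ∀ i, 0 < x i) (hr : A *ᵥ x = r • x) {z : ℂ} {y : n → ℂ} (hy : y ≠ 0)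
    (hz : (A.map (algebraMap ℝ ℂ)) *ᵥ y = z • y) : ‖z‖ ≤ r := by
  obtain ⟨j, hj⟩ := Function.ne_iff.1 hy
  have : Nonempty n := ⟨j⟩
  obtain ⟨i, hi⟩ := Finite.exists_max fun i => ‖y i‖ / x i
  set c := ‖y i‖ / x i
  have hc : 0 < c := (div_pos (norm_pos_iff.2 hj) (hx j)).trans_le (hi j)
  have h1 : ‖z‖ * ‖y i‖ ≤ c * (r * x i) := by
    calc ‖z‖ * ‖y i‖ = ‖((A.map (algebraMap ℝ ℂ)) *ᵥ y) i‖ := by rw [hz]; simp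
      _ ≤ ∑ j, ‖(algebraMap ℝ ℂ) (A i j) * y j‖ := norm_sum_le _ _
      _ ≤ ∑ j, c * (A i j * x j) := by
        refine Finset.sum_le_sum fun j _ => ?_
        rw [norm_mul, Complex.coe_algebraMap, Complex.norm_real, Real.norm_of_nonneg (hA i j),
          mul_left_comm]
        exact mul_le_mul_of_nonneg_left ((div_le_iff₀ (hx j)).1 (hi j)) (hA i j)
      _ = c * (r * x i) := by
        rw [← Finset.mul_sum]
        exact congrArg _ (congrFun hr i)
  have h2 : ‖y i‖ = c * x i := (div_mul_cancel₀ _ (hx i).ne').symm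
  rw [h2, mul_left_comm c r] at h1
  exact le_of_mul_le_mul_right h1 (mul_pos hc (hx i))

variable [DecidableEq n]

lemma mulVec_pow_eq {R : Type*} [CommSemiring R] {A : Matrix n n R} {x : n → R} {r : R}
    (h : A *ᵥ x = r • x) (m : ℕ) : (A ^ m) *ᵥ x = r ^ m • x := by
  induction m with
  | zero => simp
  | succ m ih => rw [pow_succ, ← mulVec_mulVec, h, mulVec_smul, ih, smul_smul, pow_succ']

/-- The **Perron theorem**: a primitive matrix has an eigenvector with positive entries. -/
theorem exists_pos_eigenvector [Nonempty n] {A : Matrix n n ℝ} (hA : ∀ i j, 0 ≤ A i j) {k : ℕ}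
    (hk : ∀ i j, 0 < (A ^ k) i j) : ∃ (r : ℝ) (x : n → ℝ), (∀ i, 0 < x i) ∧ A *ᵥ x = r • x := by
  let K : Set (ℝ × (n → ℝ)) := (Set.Icc 0 (∑ i, ∑ j, A i j) ×ˢ stdSimplex ℝ n) ∩
    {p | ∀ i, p.1 * p.2 i ≤ (A *ᵥ p.2) i}
  have hK : IsCompact K := by
    refine (isCompact_Icc.prod (isCompact_stdSimplex ℝ n)).inter_right ?_
    simp only [Set.ofPred_forall]
    refine isClosed_iInter fun i => isClosed_le (by fun_prop) ?_
    simp only [mulVec, dotProduct]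
    fun_prop
  have hKne : K.Nonempty := by
    obtain ⟨x, hx⟩ := (inferInstance : Nonempty (stdSimplex ℝ n))
    exact ⟨(0, x), ⟨⟨le_rfl, Finset.sum_nonneg fun i _ => Finset.sum_nonneg fun j _ => hA i j⟩, hx⟩,
      fun i => by simpa using mulVec_nonneg_of_nonneg hA hx.1 i⟩
  obtain ⟨⟨r, x⟩, ⟨⟨hr, hx⟩, hrx⟩, hmax⟩ := hK.exists_isMaxOn hKne continuous_fst.continuousOn
  simp only at hr hx hrx
  have hx0 : x ≠ 0 := by
    rintro rfl
    simpa using hx.2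
  have hpow : A *ᵥ x = r • x := by
    by_contra hne
    have hz := mulVec_pos_of_pos hk (x := A *ᵥ x - r • x) (fun i => by simpa using hrx i)
      (sub_ne_zero.2 hne)
    have hy := mulVec_pos_of_pos hk hx.1 hx0
    set y := A ^ k *ᵥ x with hydef
    have hAy : A ^ k *ᵥ (A *ᵥ x - r • x) = A *ᵥ y - r • y := by
      rw [mulVec_sub, mulVec_smul, hydef, mulVec_mulVec, mulVec_mulVec, ← pow_succ, pow_succ']
    rw [hAy] at hz
    obtain ⟨i₀, hi₀⟩ := Finite.exists_min fun i => (A *ᵥ y - r • y) i / y i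
    set e := (A *ᵥ y - r • y) i₀ / y i₀
    have he : 0 < e := div_pos (hz i₀) (hy i₀)
    have hs : 0 < ∑ i, y i := Finset.sum_pos (fun i _ => hy i) Finset.univ_nonempty
    have hmem : (∑ i, y i)⁻¹ • y ∈ stdSimplex ℝ n := by
      refine ⟨fun i => mul_nonneg (inv_nonneg.2 hs.le) (hy i).le, ?_⟩
      simp only [Pi.smul_apply, smul_eq_mul]
      rw [← Finset.mul_sum, inv_mul_cancel₀ hs.ne']
    have hle : ∀ i, (r + e) * ((∑ i, y i)⁻¹ • y) i ≤ (A *ᵥ ((∑ i, y i)⁻¹ • y)) i := by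
      intro i
      have h1 := (le_div_iff₀ (hy i)).1 (hi₀ i)
      simp only [Pi.sub_apply, Pi.smul_apply, smul_eq_mul] at h1
      rw [mulVec_smul]
      simp only [Pi.smul_apply, smul_eq_mul]
      rw [mul_left_comm]
      exact mul_le_mul_of_nonneg_left (by linarith) (inv_nonneg.2 hs.le)
    have h2 : r + e ≤ r := hmax (a := (r + e, (∑ i, y i)⁻¹ • y))
      ⟨⟨⟨by linarith [hr.1], le_sum_of_smul_le_mulVec hA hmem hle⟩, hmem⟩, hle⟩
    linarith
  refine ⟨r, x, fun i => lt_of_le_of_ne (hx.1 i) fun h0 => ?_, hpow⟩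
  have := mulVec_pos_of_pos hk hx.1 hx0 i
  rw [mulVec_pow_eq hpow] at this
  simp [← h0] at this

lemma eigenvalue_eq_of_pos_diag {A : Matrix n n ℝ} (hA : ∀ i j, 0 ≤ A i j)
    (hdiag : ∀ i, 0 < A i i) {r : ℝ} {x : n → ℝ}
    (hx : ∀ i, 0 < x i) (hr : A *ᵥ x = r • x) {z : ℂ} {y : n → ℂ} (hy : y ≠ 0)
    (hz : (A.map (algebraMap ℝ ℂ)) *ᵥ y = z • y) (hzr : r ≤ ‖z‖) : z = r := by
  obtain ⟨j, hj⟩ := Function.ne_iff.1 hy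
  have : Nonempty n := ⟨j⟩
  obtain ⟨i, hi⟩ := Finite.exists_min fun i => A i i
  set e := A i i
  have he : 0 < e := hdiag i
  have hB : ∀ i j, 0 ≤ (A - e • (1 : Matrix n n ℝ)) i j := by
    intro a b
    by_cases hab : a = b
    · subst hab
      simpa using hi a
    · simpa [one_apply_ne hab] using hA a b
  have h1 : (A - e • (1 : Matrix n n ℝ)) *ᵥ x = (r - e) • x := by
    rw [sub_mulVec, hr, smul_mulVec, one_mulVec, sub_smul]
  have h2 : ((A - e • (1 : Matrix n n ℝ)).map (algebraMap ℝ ℂ)) *ᵥ y = (z - e) • y := by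
    have : (A - e • (1 : Matrix n n ℝ)).map (algebraMap ℝ ℂ) =
        A.map (algebraMap ℝ ℂ) - (e : ℂ) • (1 : Matrix n n ℂ) := by
      ext a b
      by_cases hab : a = b
      · subst hab; simp
      · simp [one_apply_ne hab]
    rw [this, sub_mulVec, hz, smul_mulVec, one_mulVec, sub_smul]
  have h3 := norm_eigenvalue_le hB hx h1 hy h2
  have h4 : ‖z‖ = r := le_antisymm (norm_eigenvalue_le hA hx hr hy hz) hzr
  have h5 : ‖z - e‖ ^ 2 ≤ (r - e) ^ 2 := pow_le_pow_left₀ (norm_nonneg _) h3 2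
  have h6 : ‖z‖ ^ 2 = r ^ 2 := by rw [h4]
  rw [Complex.sq_norm, Complex.normSq_apply] at h5 h6
  simp only [Complex.sub_re, Complex.sub_im, Complex.ofReal_re, Complex.ofReal_im] at h5
  have h7 : r ≤ z.re := by nlinarith
  have h8 : 0 ≤ r := h4 ▸ norm_nonneg z
  have h9 : z.im = 0 := by nlinarith
  have h10 : z.re = r := by nlinarith [Complex.re_le_norm z]
  exact Complex.ext (by simpa using h10) (by simpa using h9)

lemma exists_eigenvector_of_charpoly_eval {K : Type*} [Field K] {A : Matrix n n K} {z : K}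
    (h : A.charpoly.eval z = 0) : ∃ y : n → K, y ≠ 0 ∧ A *ᵥ y = z • y := by
  rw [eval_charpoly] at h
  obtain ⟨y, hy, h0⟩ := exists_mulVec_eq_zero_iff.2 h
  refine ⟨y, hy, ?_⟩
  rw [sub_mulVec, sub_eq_zero] at h0
  rw [← h0, scalar_apply, ← smul_one_eq_diagonal, smul_mulVec, one_mulVec]

lemma charpoly_eval_eq_zero {K : Type*} [Field K] {A : Matrix n n K} {z : K} {y : n → K}
    (hy : y ≠ 0) (h : A *ᵥ y = z • y) : A.charpoly.eval z = 0 := by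
  rw [eval_charpoly]
  refine exists_mulVec_eq_zero_iff.1 ⟨y, hy, ?_⟩
  rw [sub_mulVec, sub_eq_zero, h, scalar_apply, ← smul_one_eq_diagonal, smul_mulVec, one_mulVec]

/-- The Perron eigenvalue of a primitive matrix of natural numbers is `1` or a Perron number. -/
theorem exists_pos_eigenvector_isPerronNumber [Nonempty n] (A : Matrix n n ℕ)
    (hrow : ∀ i, ∃ j, A i j ≠ 0) {k : ℕ} (hk : ∀ i j, 0 < (A ^ k) i j) :
    ∃ (r : ℝ) (x : n → ℝ), (∀ i, 0 < x i) ∧ A.map (Nat.castRingHom ℝ) *ᵥ x = r • x ∧ 1 ≤ r ∧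
      (r = 1 ∨ IsPerronNumber r) := by
  set B := A.map (Nat.castRingHom ℝ) with hBdef
  have hBpow : ∀ m i j, (B ^ m) i j = ((A ^ m) i j : ℝ) := by
    intro m i j
    rw [hBdef, ← RingHom.mapMatrix_apply, ← map_pow]
    rfl
  have hB : ∀ i j, 0 ≤ B i j := fun i j => Nat.cast_nonneg _
  have hBk : ∀ i j, 0 < (B ^ k) i j := fun i j => by
    rw [hBpow]; exact_mod_cast hk i j
  have hBk' : ∀ i j, 0 < (B ^ (k + 1)) i j := fun i j => by
    rw [hBpow]
    obtain ⟨l, hl⟩ := hrow i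
    rw [pow_succ', mul_apply]
    exact_mod_cast Finset.sum_pos' (fun _ _ => Nat.zero_le _)
      ⟨l, Finset.mem_univ l, Nat.mul_pos (Nat.pos_of_ne_zero hl) (hk l j)⟩
  obtain ⟨r, x, hx, hr⟩ := exists_pos_eigenvector hB hBk
  have hr1 : 1 ≤ r := by
    obtain ⟨i, hi⟩ := Finite.exists_min x
    obtain ⟨j, hj⟩ := hrow i
    have h1 : x i ≤ r * x i := by
      calc x i ≤ x j := hi j
        _ ≤ B i j * x j := le_mul_of_one_le_left (hx j).le
          (Nat.one_le_cast.2 (Nat.one_le_iff_ne_zero.2 hj))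
        _ ≤ (B *ᵥ x) i := Finset.single_le_sum (f := fun j => B i j * x j)
          (fun j _ => mul_nonneg (hB i j) (hx j).le) (Finset.mem_univ j)
        _ = r * x i := congrFun hr i
    exact le_of_mul_le_mul_right (by rwa [one_mul]) (hx i)
  refine ⟨r, x, hx, hr, hr1, or_iff_not_imp_left.2 fun hne => ⟨?_, lt_of_le_of_ne hr1 (Ne.symm hne),
    fun z hz hzr => ?_⟩⟩
  · refine ⟨(A.map (Nat.castRingHom ℤ)).charpoly, charpoly_monic _, ?_⟩
    rw [← Polynomial.eval_map, ← charpoly_map]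
    have hmap : (algebraMap ℤ ℝ).mapMatrix (A.map (Nat.castRingHom ℤ)) = B := by
      ext i j; simp [hBdef]
    refine Eq.trans ?_ (charpoly_eval_eq_zero (A := B) (fun h => ?_) hr)
    · rw [← hmap]; rfl
    · obtain ⟨i⟩ := ‹Nonempty n›
      exact (hx i).ne' (congrFun h i)
  · have hx0 : (fun i => (x i : ℂ)) ≠ 0 := fun h => by
      obtain ⟨i⟩ := ‹Nonempty n›
      have := congrFun h i
      simp [(hx i).ne'] at this
    have hmapQ : ∀ w : ℂ, Polynomial.aeval w (A.map (Nat.castRingHom ℚ)).charpoly =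
        (B.map (algebraMap ℝ ℂ)).charpoly.eval w := by
      intro w
      rw [Polynomial.aeval_def, ← Polynomial.eval_map, ← charpoly_map]
      congr 2
    have hC : B.map (algebraMap ℝ ℂ) *ᵥ (fun i => (x i : ℂ)) = (r : ℂ) • fun i => (x i : ℂ) := by
      ext i
      have := congrArg (algebraMap ℝ ℂ) (congrFun hr i)
      simpa [mulVec, dotProduct] using this
    have hdvd : minpoly ℚ (r : ℂ) ∣ (A.map (Nat.castRingHom ℚ)).charpoly := by
      refine minpoly.dvd _ _ ?_
      rw [hmapQ]
      exact charpoly_eval_eq_zero hx0 hC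
    have hz0 : (B.map (algebraMap ℝ ℂ)).charpoly.eval z = 0 := by
      obtain ⟨q, hq⟩ := hdvd
      rw [← hmapQ, hq, map_mul, hz.aeval_eq_zero, zero_mul]
    obtain ⟨y, hy, hyz⟩ := exists_eigenvector_of_charpoly_eval hz0
    rw [abs_of_nonneg (zero_le_one.trans hr1)]
    by_contra! hle
    have hpow : ∀ m, (∀ i j, 0 < (B ^ m) i j) → z ^ m = (r : ℂ) ^ m := by
      intro m hm
      have h1 : (B ^ m).map (algebraMap ℝ ℂ) *ᵥ y = z ^ m • y := by
        rw [← RingHom.mapMatrix_apply, map_pow]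
        exact mulVec_pow_eq hyz m
      have := eigenvalue_eq_of_pos_diag (fun i j => (hm i j).le) (fun i => hm i i) hx
        (mulVec_pow_eq hr m) hy h1 (by
          rw [norm_pow]; exact pow_le_pow_left₀ (zero_le_one.trans hr1) hle m)
      simpa using this
    have h1 := hpow k hBk
    have h2 := hpow (k + 1) hBk'
    rw [pow_succ, pow_succ, h1] at h2
    exact hzr (mul_left_cancel₀ (pow_ne_zero _ (by
      exact_mod_cast (zero_lt_one.trans_le hr1).ne')) h2)

end Matrix

namespace RACG

variable {V : Type*} [DecidableEq V] (Γ : SimpleGraph V) [DecidableRel Γ.Adj]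

/-- The transition function of the automaton of geodesics. Its states are the sets of letters that
can be brought to the end of the word read so far. -/
def step (s : Finset V) (v : V) : Finset V := insert v (s.filter (Γ.Adj v))

/-- The automaton of geodesics accepts the word `w` from the state `s`. -/
def Accepted (s : Finset V) (w : List V) : Prop := Reduced Γ w ∧ ∀ v ∈ s, Allows Γ v w

variable {Γ}

lemma mem_step {s : Finset V} {u v : V} : u ∈ step Γ s v ↔ u = v ∨ u ∈ s ∧ Γ.Adj v u := by
  simp [step]

lemma accepted_cons {s : Finset V} {x : V} {w : List V} :
    Accepted Γ s (x :: w) ↔ x ∉ s ∧ Accepted Γ (step Γ s x) w := by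
  constructor
  · rintro ⟨⟨h1, h2⟩, h3⟩
    refine ⟨fun hx => (h3 x hx).1 rfl, h2, fun v hv => ?_⟩
    rcases mem_step.1 hv with rfl | ⟨hv, hadj⟩
    · exact h1
    · exact (h3 v hv).2 hadj
  · rintro ⟨hx, h2, h3⟩
    refine ⟨⟨h3 x (mem_step.2 (Or.inl rfl)), h2⟩, fun v hv => ⟨?_, fun hadj => ?_⟩⟩
    · rintro rfl; exact hx hv
    · exact h3 v (mem_step.2 (Or.inr ⟨hv, hadj⟩))

variable [Fintype V]

variable (Γ) in
/-- The words of a given length that the automaton accepts from a given state. -/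
def words : ℕ → Finset V → Finset (List V)
  | 0, _ => {[]}
  | l + 1, s => sᶜ.biUnion fun v => (words l (step Γ s v)).image (List.cons v)

lemma mem_words {l : ℕ} {s : Finset V} {w : List V} :
    w ∈ words Γ l s ↔ w.length = l ∧ Accepted Γ s w := by
  induction l generalizing s w with
  | zero =>
    rw [words, Finset.mem_singleton, List.length_eq_zero_iff]
    exact ⟨fun h => ⟨h, h ▸ ⟨trivial, fun _ _ => trivial⟩⟩, fun h => h.1⟩
  | succ l ih =>
    simp only [words, Finset.mem_biUnion, Finset.mem_image, ih, Finset.mem_compl]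
    constructor
    · rintro ⟨v, hv, w, ⟨hl, hw⟩, rfl⟩
      exact ⟨by simp [hl], accepted_cons.2 ⟨hv, hw⟩⟩
    · rintro ⟨hl, hw⟩
      cases w with
      | nil => simp at hl
      | cons x w =>
        obtain ⟨hx, hw⟩ := accepted_cons.1 hw
        exact ⟨x, hx, w, ⟨by simpa using hl, hw⟩, rfl⟩

lemma card_words_succ (l : ℕ) (s : Finset V) :
    (words Γ (l + 1) s).card = ∑ v ∈ sᶜ, (words Γ l (step Γ s v)).card := by
  rw [words, Finset.card_biUnion]
  · exact Finset.sum_congr rfl fun v _ => Finset.card_image_of_injective _ List.cons_injective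
  · intro u _ v _ huv
    simp only [Function.onFun, Finset.disjoint_left, Finset.mem_image]
    rintro _ ⟨w, _, rfl⟩ ⟨w', _, h⟩
    exact huv (List.cons.inj h).1.symm

lemma words_subset {s t : Finset V} (h : s ⊆ t) (l : ℕ) : words Γ l t ⊆ words Γ l s := by
  intro w hw
  rw [mem_words] at hw ⊢
  exact ⟨hw.1, hw.2.1, fun v hv => hw.2.2 v (h hv)⟩

variable (Γ) in
lemma ncard_reduced (l : ℕ) :
    {w : List V | w.length = l ∧ Reduced Γ w}.ncard = (words Γ l ∅).card := by
  rw [← Set.ncard_coe_finset]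
  congr 1
  ext w
  simp [mem_words, Accepted]

variable (Γ)

/-- The vertices that are adjacent to all the other vertices. -/
def cone : Finset V := Finset.univ.filter fun v => ∀ u, u ≠ v → Γ.Adj u v

/-- A clique that meets every component of the complementary graph. -/
def Full (s : Finset V) : Prop :=
  (∀ a ∈ s, ∀ b ∈ s, a ≠ b → Γ.Adj a b) ∧ ∀ v, ∃ a ∈ s, Γᶜ.Reachable a v

variable {Γ}

lemma mem_cone {v : V} : v ∈ cone Γ ↔ ∀ u, u ≠ v → Γ.Adj u v := by
  simp [cone]

omit [DecidableEq V] [DecidableRel Γ.Adj] [Fintype V] in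
lemma compl_adj_of_not_adj {a b : V} (h : a ≠ b) (hadj : ¬ Γ.Adj a b) : Γᶜ.Adj a b :=
  (SimpleGraph.compl_adj _ _ _).2 ⟨h, hadj⟩

omit [Fintype V] in
lemma Full.step {s : Finset V} (hs : Full Γ s) {v : V} (hv : v ∉ s) : Full Γ (step Γ s v) := by
  refine ⟨fun a ha b hb hab => ?_, fun y => ?_⟩
  · rcases mem_step.1 ha with rfl | ⟨ha, hva⟩ <;> rcases mem_step.1 hb with rfl | ⟨hb, hvb⟩
    · exact absurd rfl hab
    · exact hvb
    · exact hva.symm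
    · exact hs.1 a ha b hb hab
  · obtain ⟨a, ha, hay⟩ := hs.2 y
    by_cases hva : Γ.Adj v a
    · exact ⟨a, mem_step.2 (Or.inr ⟨ha, hva⟩), hay⟩
    · have hne : v ≠ a := fun h => hv (h ▸ ha)
      exact ⟨v, mem_step.2 (Or.inl rfl), (compl_adj_of_not_adj hne hva).reachable.trans hay⟩

lemma exists_compl_adj_of_not_mem_cone {v : V} (hv : v ∉ cone Γ) : ∃ u, Γᶜ.Adj v u := by
  rw [mem_cone] at hv
  push Not at hv
  obtain ⟨u, hu, h⟩ := hv
  exact ⟨u, (compl_adj_of_not_adj hu h).symm⟩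

omit [DecidableEq V] [DecidableRel Γ.Adj] [Fintype V] in
lemma exists_allows {x : V} (hx : ∃ y, Γᶜ.Adj x y) (w : List V) :
    ∃ v, Γᶜ.Reachable x v ∧ Allows Γ v w := by
  induction w with
  | nil => exact ⟨x, .refl x, trivial⟩
  | cons a w ih =>
    by_cases ha : Γᶜ.Reachable x a
    · have hn : ∃ v, Γᶜ.Adj a v := by
        obtain ⟨p⟩ := ha.symm
        cases p with
        | nil => exact hx
        | cons h _ => exact ⟨_, h⟩
      obtain ⟨v, hv⟩ := hn
      exact ⟨v, ha.trans hv.reachable, hv.ne, fun h => absurd h ((SimpleGraph.compl_adj _ _ _).1 hv).2⟩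
    · obtain ⟨v, hxv, hv⟩ := ih
      exact ⟨v, hxv, fun h => ha (h ▸ hxv), fun _ => hv⟩

lemma exists_full_accepted {w : List V} (hw : Reduced Γ w) :
    ∃ s, Full Γ (s ∪ cone Γ) ∧ Accepted Γ s w := by
  classical
  have hg : ∀ x, ∃ v, Γᶜ.Reachable x v ∧ (x ∈ cone Γ → v = x) ∧ (x ∉ cone Γ → Allows Γ v w) := by
    intro x
    by_cases hx : x ∈ cone Γ
    · exact ⟨x, .refl x, fun _ => rfl, fun h => absurd hx h⟩
    · obtain ⟨v, hv, hvw⟩ := exists_allows (exists_compl_adj_of_not_mem_cone hx) w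
      exact ⟨v, hv, fun h => absurd h hx, fun _ => hvw⟩
  choose g hg1 hg2 hg3 using hg
  let f : Γᶜ.ConnectedComponent → V := fun C => g C.out
  have hf : ∀ C, Γᶜ.connectedComponentMk (f C) = C := fun C => by
    conv_rhs => rw [← C.out_eq]
    exact SimpleGraph.ConnectedComponent.sound (hg1 _).symm
  have hmem : ∀ a, a ∈ (Finset.univ.image f \ cone Γ) ∪ cone Γ ↔ (∃ C, f C = a) ∨ a ∈ cone Γ := by
    intro a
    by_cases ha : a ∈ cone Γ <;> simp [ha]
  refine ⟨Finset.univ.image f \ cone Γ, ⟨fun a ha b hb hab => ?_, fun v => ?_⟩, hw, fun v hv => ?_⟩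
  · rcases (hmem a).1 ha with ⟨C, rfl⟩ | ha
    · rcases (hmem b).1 hb with ⟨D, rfl⟩ | hb
      · by_contra hadj
        have : C = D := by
          rw [← hf C, ← hf D]
          exact SimpleGraph.ConnectedComponent.sound (compl_adj_of_not_adj hab hadj).reachable
        exact hab (this ▸ rfl)
      · exact mem_cone.1 hb _ hab
    · exact (mem_cone.1 ha _ hab.symm).symm
  · exact ⟨f (Γᶜ.connectedComponentMk v), (hmem _).2 (Or.inl ⟨_, rfl⟩),
      SimpleGraph.ConnectedComponent.exact (hf _)⟩
  · rw [Finset.mem_sdiff, Finset.mem_image] at hv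
    obtain ⟨⟨C, -, rfl⟩, hC⟩ := hv
    refine hg3 _ fun h => hC ?_
    change g C.out ∈ cone Γ
    rwa [hg2 _ h]

variable (Γ) in
lemma exists_full : ∃ s, Full Γ s :=
  (exists_full_accepted (w := []) trivial).imp' _ fun _ h => h.1

lemma mul_pow_le_card_words {h : Finset V → ℝ} {M r : ℝ} (hM : ∀ s, Full Γ s → h s ≤ M)
    (heig : ∀ s, Full Γ s → ∑ v ∈ sᶜ, h (step Γ s v) = r * h s) (l : ℕ) :
    ∀ s, Full Γ s → h s * r ^ l ≤ M * (words Γ l s).card := by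
  induction l with
  | zero => intro s hs; simpa [words] using hM s hs
  | succ l ih =>
    intro s hs
    calc h s * r ^ (l + 1) = ∑ v ∈ sᶜ, h (step Γ s v) * r ^ l := by
          rw [← Finset.sum_mul, heig s hs]; ring
      _ ≤ ∑ v ∈ sᶜ, M * ((words Γ l (step Γ s v)).card : ℝ) :=
          Finset.sum_le_sum fun v hv => ih _ (hs.step (Finset.mem_compl.1 hv))
      _ = M * ((words Γ (l + 1) s).card : ℝ) := by
          rw [← Finset.mul_sum, card_words_succ]; push_cast; rfl

lemma step_union_cone {s : Finset V} {v : V} (hv : v ∉ cone Γ) :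
    step Γ (s ∪ cone Γ) v = step Γ s v ∪ cone Γ := by
  ext u
  simp only [mem_step, Finset.mem_union]
  by_cases hu : u ∈ cone Γ
  · have : Γ.Adj v u := mem_cone.1 hu v fun h => hv (h ▸ hu)
    simp [hu, this]
  · simp [hu]

lemma cone_sdiff_step {s : Finset V} {v : V} (hv : v ∉ cone Γ) :
    cone Γ \ step Γ s v = cone Γ \ s := by
  ext u
  simp only [mem_step, Finset.mem_sdiff]
  refine and_congr_right fun hu => not_congr ?_
  have hne : u ≠ v := fun h => hv (h ▸ hu)
  simp [hne, mem_cone.1 hu v hne.symm]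

lemma step_of_mem_cone {s : Finset V} {z : V} (hz : z ∈ cone Γ) (hzs : z ∉ s) :
    step Γ s z = insert z s := by
  rw [step, Finset.filter_true_of_mem]
  intro u hu
  exact (mem_cone.1 hz u fun h => hzs (h ▸ hu)).symm

lemma card_words_le_mul_pow {h : Finset V → ℝ} {m r : ℝ} (hm0 : 0 < m)
    (hm : ∀ s, Full Γ s → m ≤ h s)
    (hr : 1 ≤ r) (heig : ∀ s, Full Γ s → ∑ v ∈ sᶜ, h (step Γ s v) = r * h s) (l : ℕ) :
    ∀ s, Full Γ (s ∪ cone Γ) →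
      m * (words Γ l s).card ≤ ((l : ℝ) + 1) ^ (cone Γ \ s).card * r ^ l * h (s ∪ cone Γ) := by
  induction l with
  | zero => intro s hs; simpa [words] using hm _ hs
  | succ l ih =>
    intro s hs
    set k := (cone Γ \ s).card with hk
    have hr0 : 0 ≤ r ^ l := pow_nonneg (zero_le_one.trans hr) l
    have hh : 0 ≤ h (s ∪ cone Γ) := hm0.le.trans (hm _ hs)
    have hsplit : sᶜ = (s ∪ cone Γ)ᶜ ∪ (cone Γ \ s) := by
      ext u
      by_cases hu : u ∈ cone Γ <;> simp [hu]
    have hdisj : Disjoint (s ∪ cone Γ)ᶜ (cone Γ \ s) := by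
      rw [Finset.disjoint_left]
      intro u hu hu'
      simp only [Finset.mem_compl, Finset.mem_union, Finset.mem_sdiff] at hu hu'
      exact hu (Or.inr hu'.1)
    have h1 : ∑ v ∈ (s ∪ cone Γ)ᶜ, m * ((words Γ l (step Γ s v)).card : ℝ) ≤
        ((l : ℝ) + 1) ^ k * r ^ l * (r * h (s ∪ cone Γ)) := by
      rw [← heig _ hs, Finset.mul_sum]
      refine Finset.sum_le_sum fun v hv => ?_
      have hv' := Finset.mem_compl.1 hv
      have hvc : v ∉ cone Γ := fun h => hv' (Finset.mem_union_right _ h)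
      have := ih (step Γ s v) (step_union_cone hvc ▸ hs.step hv')
      rwa [cone_sdiff_step hvc, ← step_union_cone hvc] at this
    have h2 : ∑ v ∈ cone Γ \ s, m * ((words Γ l (step Γ s v)).card : ℝ) ≤
        k * (((l : ℝ) + 1) ^ (k - 1) * r ^ l * h (s ∪ cone Γ)) := by
      rw [hk, ← nsmul_eq_mul]
      refine Finset.sum_le_card_nsmul _ _ _ fun z hz => ?_
      obtain ⟨hzc, hzs⟩ := Finset.mem_sdiff.1 hz
      have hun : insert z s ∪ cone Γ = s ∪ cone Γ := by
        rw [Finset.insert_union, Finset.insert_eq_self]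
        exact Finset.mem_union_right _ hzc
      have hcard : (cone Γ \ insert z s).card = (cone Γ \ s).card - 1 := by
        rw [← Finset.card_erase_of_mem hz]
        congr 1
        ext u
        simp only [Finset.mem_sdiff, Finset.mem_insert, Finset.mem_erase]
        tauto
      have := ih (insert z s) (by rwa [hun])
      rw [step_of_mem_cone hzc hzs]
      rwa [hun, hcard] at this
    have h3 : ((l : ℝ) + 1) ^ k + k * ((l : ℝ) + 1) ^ (k - 1) ≤ ((l : ℝ) + 1 + 1) ^ k := by
      have hl : (0 : ℝ) < (l : ℝ) + 1 := by positivity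
      rcases Nat.eq_zero_or_pos k with hk0 | hk0
      · simp [hk0]
      · have hb := one_add_mul_le_pow (a := ((l : ℝ) + 1)⁻¹)
          (by linarith [inv_pos.2 hl]) k
        have hmul := mul_le_mul_of_nonneg_left hb (pow_pos hl k).le
        rw [← mul_pow, mul_add, mul_one, mul_add, mul_one, mul_inv_cancel₀ hl.ne'] at hmul
        refine le_trans (le_of_eq ?_) hmul
        congr 1
        obtain ⟨j, hj⟩ := Nat.exists_eq_add_of_le' hk0
        rw [hj, Nat.add_sub_cancel, pow_succ]
        field_simp
    calc m * ((words Γ (l + 1) s).card : ℝ)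
        = ∑ v ∈ sᶜ, m * ((words Γ l (step Γ s v)).card : ℝ) := by
          rw [← Finset.mul_sum, card_words_succ]; push_cast; rfl
      _ ≤ ((l : ℝ) + 1) ^ k * r ^ l * (r * h (s ∪ cone Γ)) +
          k * (((l : ℝ) + 1) ^ (k - 1) * r ^ l * h (s ∪ cone Γ)) := by
          rw [hsplit, Finset.sum_union hdisj]
          exact add_le_add h1 h2
      _ ≤ ((l : ℝ) + 1) ^ k * r ^ l * (r * h (s ∪ cone Γ)) +
          k * (((l : ℝ) + 1) ^ (k - 1) * r ^ l * h (s ∪ cone Γ)) * r := by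
          exact add_le_add le_rfl (le_mul_of_one_le_right (by positivity) hr)
      _ = (((l : ℝ) + 1) ^ k + k * ((l : ℝ) + 1) ^ (k - 1)) * (r ^ (l + 1) * h (s ∪ cone Γ)) := by
          ring
      _ ≤ ((l : ℝ) + 1 + 1) ^ k * (r ^ (l + 1) * h (s ∪ cone Γ)) :=
          mul_le_mul_of_nonneg_right h3 (by positivity)
      _ = (((l + 1 : ℕ) : ℝ) + 1) ^ k * r ^ (l + 1) * h (s ∪ cone Γ) := by
          push_cast; ring

end RACG

open Filter Topology in
lemma limsup_rpow_eq_of_bounds {b : ℕ → ℝ} {c C r : ℝ} {d : ℕ} (hc : 0 < c) (hC : 0 < C)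
    (hr : 0 < r) (hl : ∀ l, c * r ^ l ≤ b l) (hu : ∀ l, b l ≤ C * ((l : ℝ) + 1) ^ d * r ^ l) :
    limsup (fun l : ℕ => b l ^ (1 / (l : ℝ))) atTop = r := by
  have hconst : ∀ a : ℝ, 0 < a → Tendsto (fun l : ℕ => a ^ (1 / (l : ℝ))) atTop (𝓝 1) := by
    intro a ha
    have := (tendsto_const_nhds (x := a)).rpow tendsto_one_div_atTop_nhds_zero_nat
      (Or.inl ha.ne')
    simpa using this
  have hlin : Tendsto (fun l : ℕ => ((l : ℝ) + 1) ^ (1 / (l : ℝ))) atTop (𝓝 1) := by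
    have h1 : Tendsto (fun x : ℝ => (1 * x + 1) ^ (1 / (1 * x + 0))) atTop (𝓝 1) := by
      have h2 := (tendsto_rpow_div_mul_add 1 1 (-1) zero_ne_one).comp
        (tendsto_atTop_add_const_right atTop (1 : ℝ) tendsto_id)
      refine h2.congr fun x => ?_
      simp
    refine (h1.comp tendsto_natCast_atTop_atTop).congr fun l => ?_
    simp
  have hroot : ∀ l : ℕ, l ≠ 0 → (r ^ l) ^ (1 / (l : ℝ)) = r := fun l hl0 => by
    rw [one_div, Real.pow_rpow_inv_natCast hr.le hl0]
  refine Tendsto.limsup_eq (tendsto_of_tendsto_of_tendsto_of_le_of_le'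
    (g := fun l : ℕ => c ^ (1 / (l : ℝ)) * r)
    (h := fun l : ℕ => C ^ (1 / (l : ℝ)) * (((l : ℝ) + 1) ^ (1 / (l : ℝ))) ^ d * r) ?_ ?_ ?_ ?_)
  · simpa using (hconst c hc).mul_const r
  · simpa using ((hconst C hC).mul (hlin.pow d)).mul_const r
  · filter_upwards [eventually_ne_atTop 0] with l hl0
    calc c ^ (1 / (l : ℝ)) * r = (c * r ^ l) ^ (1 / (l : ℝ)) := by
          rw [Real.mul_rpow hc.le (by positivity), hroot l hl0]
      _ ≤ _ := Real.rpow_le_rpow (by positivity) (hl l) (by positivity)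
  · filter_upwards [eventually_ne_atTop 0] with l hl0
    calc b l ^ (1 / (l : ℝ)) ≤ (C * ((l : ℝ) + 1) ^ d * r ^ l) ^ (1 / (l : ℝ)) :=
          Real.rpow_le_rpow (le_trans (by positivity) (hl l)) (hu l) (by positivity)
      _ = _ := by
          rw [Real.mul_rpow (by positivity) (by positivity), hroot l hl0,
            Real.mul_rpow hC.le (by positivity), Real.rpow_pow_comm (by positivity)]

namespace RACG

variable {V : Type*} [DecidableEq V] {Γ : SimpleGraph V} [DecidableRel Γ.Adj] [Fintype V]

open Classical in
lemma card_words_empty_le (l : ℕ) : (words Γ l ∅).card ≤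
    ∑ s ∈ Finset.univ.filter (fun s => Full Γ (s ∪ cone Γ)), (words Γ l s).card := by
  refine (Finset.card_le_card fun w hw => ?_).trans Finset.card_biUnion_le
  rw [mem_words] at hw
  obtain ⟨s, hs, hsw⟩ := exists_full_accepted hw.2.1
  exact Finset.mem_biUnion.2 ⟨s, by simpa using hs, mem_words.2 ⟨hw.1, hsw⟩⟩

theorem geodesicGrowthRate_eq {h : Finset V → ℝ} {r : ℝ} (hpos : ∀ s, Full Γ s → 0 < h s)
    (hr : 1 ≤ r) (heig : ∀ s, Full Γ s → ∑ v ∈ sᶜ, h (step Γ s v) = r * h s) :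
    geodesicGrowthRate (racgGenerators Γ) = r := by
  classical
  obtain ⟨s₀, hs₀⟩ := exists_full Γ
  have hne : (Finset.univ.filter (Full Γ)).Nonempty := ⟨s₀, by simpa using hs₀⟩
  obtain ⟨s₁, hs₁, hmin⟩ := Finset.exists_min_image _ h hne
  obtain ⟨s₂, hs₂, hmax⟩ := Finset.exists_max_image _ h hne
  simp only [Finset.mem_filter, Finset.mem_univ, true_and] at hs₁ hs₂ hmin hmax
  have h1 := hpos s₁ hs₁
  have h2 := hpos s₂ hs₂
  have hr0 : 0 < r := zero_lt_one.trans_le hr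
  unfold geodesicGrowthRate
  simp only [ncard_geodesicsFromOne, ncard_reduced]
  refine limsup_rpow_eq_of_bounds (c := h s₀ / h s₂)
    (C := Fintype.card (Finset V) * (h s₂ / h s₁)) (d := Fintype.card V)
    (div_pos (hpos s₀ hs₀) h2) (by positivity) hr0 (fun l => ?_) (fun l => ?_)
  · rw [div_mul_eq_mul_div, div_le_iff₀' h2]
    refine (mul_pow_le_card_words hmax heig l s₀ hs₀).trans (mul_le_mul_of_nonneg_left ?_ h2.le)
    exact_mod_cast Finset.card_le_card (words_subset (Finset.empty_subset _) l)
  · have hle : ∀ s ∈ Finset.univ.filter (fun s => Full Γ (s ∪ cone Γ)),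
        ((words Γ l s).card : ℝ) ≤
          h s₂ / h s₁ * (((l : ℝ) + 1) ^ Fintype.card V * r ^ l) := by
      intro s hs
      have hs' : Full Γ (s ∪ cone Γ) := by simpa using hs
      rw [div_mul_eq_mul_div, le_div_iff₀' h1, mul_comm (h s₂)]
      refine (card_words_le_mul_pow h1 hmin hr heig l s hs').trans ?_
      refine mul_le_mul (mul_le_mul_of_nonneg_right ?_ (by positivity)) (hmax _ hs')
        (hpos _ hs').le (by positivity)
      exact pow_le_pow_right₀ (by linarith [Nat.cast_nonneg (α := ℝ) l]) (Finset.card_le_univ _)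
    calc ((words Γ l ∅).card : ℝ)
        ≤ ∑ s ∈ Finset.univ.filter (fun s => Full Γ (s ∪ cone Γ)), ((words Γ l s).card : ℝ) := by
          exact_mod_cast card_words_empty_le l
      _ ≤ (Finset.univ.filter (fun s => Full Γ (s ∪ cone Γ))).card •
          (h s₂ / h s₁ * (((l : ℝ) + 1) ^ Fintype.card V * r ^ l)) :=
          Finset.sum_le_card_nsmul _ _ _ hle
      _ ≤ Fintype.card (Finset V) * (h s₂ / h s₁ * (((l : ℝ) + 1) ^ Fintype.card V * r ^ l)) := by
          rw [nsmul_eq_mul]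
          refine mul_le_mul_of_nonneg_right ?_ (by positivity)
          exact_mod_cast Finset.card_le_univ _
      _ = _ := by ring

end RACG

namespace SimpleGraph

lemma exists_walk_covering {V : Type*} [Finite V] {H : SimpleGraph V} {a v : V}
    (h : H.Reachable a v) : ∃ p : H.Walk a v, ∀ y, H.Reachable y v → y ∈ p.support := by
  classical
  cases nonempty_fintype V
  have key : ∀ F : Finset V, ∃ p : H.Walk a v, ∀ y ∈ F, H.Reachable y v → y ∈ p.support := by
    intro F
    induction F using Finset.induction_on with
    | empty => exact h.elim fun p => ⟨p, by simp⟩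
    | insert y F _ ih =>
      obtain ⟨p, hp⟩ := ih
      by_cases hy : H.Reachable y v
      · obtain ⟨q⟩ := hy
        refine ⟨p.append (q.reverse.append q), fun x hx hxv => ?_⟩
        rw [Walk.mem_support_append_iff, Walk.mem_support_append_iff]
        rcases Finset.mem_insert.1 hx with rfl | hx
        · exact Or.inr (Or.inr q.start_mem_support)
        · exact Or.inl (hp x hx hxv)
      · refine ⟨p, fun x hx hxv => ?_⟩
        rcases Finset.mem_insert.1 hx with rfl | hx
        · exact absurd hxv hy
        · exact hp x hx hxv
  obtain ⟨p, hp⟩ := key Finset.univ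
  exact ⟨p, fun y => hp y (Finset.mem_univ y)⟩

lemma Reachable.eq_or_adj {V : Type*} {H : SimpleGraph V}
    (hdeg : ∀ a b c, H.Adj b a → H.Adj b c → a = c) {a b : V} (h : H.Reachable a b) :
    a = b ∨ H.Adj a b := by
  obtain ⟨p⟩ := h
  induction p with
  | nil => exact Or.inl rfl
  | cons hadj p ih =>
    rcases ih with rfl | hadj'
    · exact Or.inr hadj
    · exact Or.inl (hdeg _ _ _ hadj.symm hadj')

end SimpleGraph

namespace RACG

variable {V : Type*} [DecidableEq V] (Γ : SimpleGraph V) [DecidableRel Γ.Adj]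

/-- There is a path of the given length between two states of the automaton of geodesics. -/
inductive StatePath : ℕ → Finset V → Finset V → Prop
  | nil (s : Finset V) : StatePath 0 s s
  | cons {k : ℕ} {s t : Finset V} {v : V} (hv : v ∉ s) (h : StatePath k (step Γ s v) t) :
      StatePath (k + 1) s t

variable {Γ}

lemma StatePath.trans {k l : ℕ} {s t u : Finset V} (h : StatePath Γ k s t)
    (h' : StatePath Γ l t u) : StatePath Γ (k + l) s u := by
  induction h with
  | nil s => rwa [zero_add]
  | @cons k s t v hv h ih =>
    rw [Nat.add_right_comm]
    exact .cons hv (ih h')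

lemma StatePath.full {k : ℕ} {s t : Finset V} (h : StatePath Γ k s t) (hs : Full Γ s) :
    Full Γ t := by
  induction h with
  | nil => exact hs
  | cons hv _ ih => exact ih (hs.step hv)

lemma adj_of_not_reachable {x y : V} (h : ¬ Γᶜ.Reachable x y) : Γ.Adj x y := by
  by_contra hadj
  refine h ?_
  by_cases hxy : x = y
  · rw [hxy]
  · exact (compl_adj_of_not_adj hxy hadj).reachable

lemma Full.statePath_walk {u v : V} (p : Γᶜ.Walk u v) {s : Finset V} (hs : Full Γ s)
    (hu : u ∈ s) :
    StatePath Γ p.length s (insert v (s.filter fun x => ∀ y ∈ p.support.tail, Γ.Adj x y)) := by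
  induction p generalizing s with
  | nil => simpa [hu] using StatePath.nil s
  | @cons u w v hadj p ih =>
    have hnadj : ¬ Γ.Adj u w := ((SimpleGraph.compl_adj _ _ _).1 hadj).2
    have hw : w ∉ s := fun h => hnadj (hs.1 u hu w h hadj.ne)
    refine .cons hw ?_
    convert ih (hs.step hw) (mem_step.2 (Or.inl rfl)) using 1
    ext x
    rw [Finset.mem_insert, Finset.mem_insert, Finset.mem_filter, Finset.mem_filter, mem_step,
      SimpleGraph.Walk.support_cons, List.tail_cons]
    by_cases hxv : x = v
    · simp [hxv]
    · simp only [hxv, false_or]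
      rw [← SimpleGraph.Walk.cons_tail_support p]
      simp only [List.forall_mem_cons, List.tail_cons]
      constructor
      · rintro ⟨hx, hxw, h⟩
        exact ⟨Or.inr ⟨hx, hxw.symm⟩, h⟩
      · rintro ⟨rfl | ⟨hx, hwx⟩, h⟩
        · cases p with
          | nil => exact absurd rfl hxv
          | cons hadj' p =>
            exact absurd (h _ (by simp)) ((SimpleGraph.compl_adj _ _ _).1 hadj').2
        · exact ⟨hx, hwx.symm, h⟩

variable [Fintype V]

open Classical in
/-- Some path replaces the part of a state in one component by a given vertex. -/
lemma Full.exists_statePath_replace {s : Finset V} (hs : Full Γ s) (v : V) :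
    ∃ k, StatePath Γ k s (insert v (s.filter fun x => ¬ Γᶜ.Reachable x v)) := by
  obtain ⟨a, ha, hav⟩ := hs.2 v
  obtain ⟨p, hp⟩ := SimpleGraph.exists_walk_covering hav
  refine ⟨p.length, ?_⟩
  convert hs.statePath_walk p ha using 1
  ext x
  simp only [Finset.mem_insert, Finset.mem_filter]
  by_cases hxv : x = v
  · simp [hxv]
  refine or_congr_right (and_congr_right fun _ => ⟨fun hx y hy => ?_, fun hx hreach => ?_⟩)
  · obtain ⟨q⟩ : Γᶜ.Reachable y v := ⟨p.dropUntil y (List.mem_of_mem_tail hy)⟩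
    exact adj_of_not_reachable fun h => hx (h.trans ⟨q⟩)
  · have hxp := hp x hreach
    cases p with
    | nil => exact hxv (by simpa using hxp)
    | cons hadj p =>
      rw [SimpleGraph.Walk.support_cons, List.tail_cons] at hx
      rw [SimpleGraph.Walk.support_cons] at hxp
      rcases List.mem_cons.1 hxp with rfl | hxp
      · exact ((SimpleGraph.compl_adj _ _ _).1 hadj).2 (hx _ p.start_mem_support)
      · exact (hx x hxp).ne rfl

open Classical in
lemma Full.exists_statePath {s t : Finset V} (hs : Full Γ s) (ht : Full Γ t) :
    ∃ k, StatePath Γ k s t := by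
  have key : ∀ F ⊆ t, ∃ k, StatePath Γ k s (F ∪ s.filter fun x => ∀ y ∈ F, ¬ Γᶜ.Reachable x y) := by
    intro F
    induction F using Finset.induction_on with
    | empty => exact fun _ => ⟨0, by simpa using StatePath.nil s⟩
    | insert v F hvF ih =>
      intro hF
      obtain ⟨hvt, hFt⟩ := Finset.insert_subset_iff.1 hF
      obtain ⟨k, hk⟩ := ih hFt
      by_cases hv : ∃ y ∈ F, Γᶜ.Reachable v y
      · obtain ⟨y, hy, hvy⟩ := hv
        refine ⟨k + 1, hk.trans (.cons (v := v) ?_ ?_)⟩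
        · simp only [Finset.mem_union, hvF, Finset.mem_filter, false_or, not_and]
          exact fun _ h => h y hy hvy
        · convert StatePath.nil (Γ := Γ) _ using 1
          ext x
          simp only [mem_step, Finset.mem_union, Finset.mem_insert, Finset.mem_filter,
            forall_eq_or_imp]
          by_cases hxv : x = v
          · simp [hxv]
          · by_cases hxF : x ∈ F
            · simp [hxF, ht.1 v hvt x (hFt hxF) (Ne.symm hxv)]
            · simp only [hxv, hxF, false_or, and_assoc]
              refine and_congr_right fun _ => ?_
              have h1 : (∀ a ∈ F, ¬ Γᶜ.Reachable x a) → ¬ Γᶜ.Reachable x v :=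
                fun h h' => h y hy (h'.trans hvy)
              have h2 : ¬ Γᶜ.Reachable x v → Γ.Adj v x := fun h => (adj_of_not_reachable h).symm
              tauto
      · push Not at hv
        obtain ⟨l, hl⟩ := (hk.full hs).exists_statePath_replace v
        refine ⟨k + l, hk.trans ?_⟩
        convert hl using 1
        ext x
        simp only [Finset.mem_union, Finset.mem_insert, Finset.mem_filter, forall_eq_or_imp]
        by_cases hxF : x ∈ F
        · have : ¬ Γᶜ.Reachable x v := fun h => hv x hxF h.symm
          simp [hxF, this]
        · simp only [hxF, or_false, false_or]
          tauto
  obtain ⟨k, hk⟩ := key t subset_rfl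
  refine ⟨k, ?_⟩
  convert hk using 1
  rw [eq_comm, Finset.union_eq_left]
  intro x hx
  obtain ⟨y, hy, hyx⟩ := ht.2 x
  exact absurd hyx.symm ((Finset.mem_filter.1 hx).2 y hy)

open Classical in
lemma step_insert_filter {s : Finset V} {b u v : V} (hub : Γᶜ.Reachable u b) (huv : Γᶜ.Adj u v) :
    v ∉ insert u (s.filter fun x => ¬ Γᶜ.Reachable x b) ∧
      step Γ (insert u (s.filter fun x => ¬ Γᶜ.Reachable x b)) v =
        insert v (s.filter fun x => ¬ Γᶜ.Reachable x b) := by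
  have hvb : Γᶜ.Reachable v b := huv.symm.reachable.trans hub
  refine ⟨by simp [huv.ne', hvb], ?_⟩
  ext x
  simp only [mem_step, Finset.mem_insert, Finset.mem_filter]
  have h1 : x = u → ¬ Γ.Adj v x := by
    rintro rfl
    exact ((SimpleGraph.compl_adj _ _ _).1 huv.symm).2
  have h2 : ¬ Γᶜ.Reachable x b → Γ.Adj v x := fun h =>
    (adj_of_not_reachable fun h' => h (h'.trans hvb)).symm
  tauto

/-- Some state has loops of all lengths from `2` on. -/
lemma exists_loops {a b c : V} (ha : Γᶜ.Adj b a) (hc : Γᶜ.Adj b c) (hac : a ≠ c) :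
    ∃ s, Full Γ s ∧ ∀ n, StatePath Γ (n + 2) s s := by
  classical
  obtain ⟨s, hs⟩ := exists_full Γ
  obtain ⟨k, hk⟩ := hs.exists_statePath_replace b
  have hba := step_insert_filter (s := s) (.refl b) ha
  have hab := step_insert_filter (s := s) ha.symm.reachable ha.symm
  have hcb := step_insert_filter (s := s) hc.symm.reachable hc.symm
  have h2 : StatePath Γ 2 (insert b (s.filter fun x => ¬ Γᶜ.Reachable x b))
      (insert b (s.filter fun x => ¬ Γᶜ.Reachable x b)) := by
    refine .cons hba.1 ?_
    rw [hba.2]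
    refine .cons hab.1 ?_
    rw [hab.2]
    exact .nil _
  have h3 : StatePath Γ 3 (insert b (s.filter fun x => ¬ Γᶜ.Reachable x b))
      (insert b (s.filter fun x => ¬ Γᶜ.Reachable x b)) := by
    refine .cons hba.1 ?_
    rw [hba.2]
    by_cases hadj : Γ.Adj a c
    · have hcn : c ∉ insert a (s.filter fun x => ¬ Γᶜ.Reachable x b) := by
        simp [hac.symm, hc.symm.reachable]
      have hbn : b ∉ step Γ (insert a (s.filter fun x => ¬ Γᶜ.Reachable x b)) c := by
        simp [mem_step, hc.ne, ha.ne]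
      refine .cons hcn (.cons hbn ?_)
      convert StatePath.nil (Γ := Γ) _ using 1
      ext x
      simp only [mem_step, Finset.mem_insert, Finset.mem_filter]
      have h1 : x = a → ¬ Γ.Adj b x := by
        rintro rfl
        exact ((SimpleGraph.compl_adj _ _ _).1 ha).2
      have h1' : x = c → ¬ Γ.Adj b x := by
        rintro rfl
        exact ((SimpleGraph.compl_adj _ _ _).1 hc).2
      have h2 : ¬ Γᶜ.Reachable x b → Γ.Adj b x := fun h => (adj_of_not_reachable h).symm
      have h2' : ¬ Γᶜ.Reachable x b → Γ.Adj c x := fun h =>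
        (adj_of_not_reachable fun h' => h (h'.trans hc.symm.reachable)).symm
      tauto
    · have hac' := step_insert_filter (s := s) ha.symm.reachable (compl_adj_of_not_adj hac hadj)
      refine .cons hac'.1 ?_
      rw [hac'.2]
      refine .cons hcb.1 ?_
      rw [hcb.2]
      exact .nil _
  refine ⟨_, hk.full hs, fun n => ?_⟩
  induction n using Nat.twoStepInduction with
  | zero => exact h2
  | one => exact h3
  | more n ih _ => exact ih.trans h2

variable (Γ) in
open Classical in
/-- The transition matrix of the automaton of geodesics on the full states. -/
noncomputable def transitionMatrix : Matrix {s // Full Γ s} {s // Full Γ s} ℕ :=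
  fun s t => (s.1ᶜ.filter fun v => step Γ s.1 v = t.1).card

open Classical in
lemma StatePath.transitionMatrix_pow_pos {k : ℕ} {s t : Finset V} (h : StatePath Γ k s t)
    (hs : Full Γ s) (ht : Full Γ t) : 0 < (transitionMatrix Γ ^ k) ⟨s, hs⟩ ⟨t, ht⟩ := by
  induction h with
  | nil s => simp
  | @cons k s t v hv h ih =>
    rw [pow_succ', Matrix.mul_apply]
    refine Finset.sum_pos' (fun _ _ => Nat.zero_le _)
      ⟨⟨_, hs.step hv⟩, Finset.mem_univ _, Nat.mul_pos ?_ (ih (hs.step hv) ht)⟩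
    exact Finset.card_pos.2 ⟨v, by simpa using hv⟩

open Classical in
lemma exists_transitionMatrix_pow_pos {a b c : V} (ha : Γᶜ.Adj b a) (hc : Γᶜ.Adj b c)
    (hac : a ≠ c) : ∃ k, ∀ s t, 0 < (transitionMatrix Γ ^ k) s t := by
  obtain ⟨s₀, hs₀, hloop⟩ := exists_loops ha hc hac
  choose p hp using fun s : {s // Full Γ s} => s.2.exists_statePath hs₀
  choose q hq using fun s : {s // Full Γ s} => hs₀.exists_statePath s.2
  refine ⟨∑ s, p s + ∑ s, q s + 2, fun s t => ?_⟩
  have h1 : p s ≤ ∑ s, p s := Finset.single_le_sum (fun _ _ => Nat.zero_le _) (Finset.mem_univ s)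
  have h2 : q t ≤ ∑ s, q s := Finset.single_le_sum (fun _ _ => Nat.zero_le _) (Finset.mem_univ t)
  have h3 := ((hp s).trans (hloop (∑ s, p s - p s + (∑ s, q s - q t)))).trans (hq t)
  have h4 : p s + (∑ s, p s - p s + (∑ s, q s - q t) + 2) + q t = ∑ s, p s + ∑ s, q s + 2 := by
    omega
  rw [h4] at h3
  exact h3.transitionMatrix_pow_pos s.2 t.2

omit [DecidableRel Γ.Adj] in
lemma Full.exists_not_mem {a b : V} (hab : Γᶜ.Adj a b) {s : Finset V} (hs : Full Γ s) :
    ∃ v, v ∉ s := by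
  by_contra! h
  exact ((SimpleGraph.compl_adj _ _ _).1 hab).2 (hs.1 a (h a) b (h b) hab.ne)

lemma growth_of_primitive {a b c : V} (ha : Γᶜ.Adj b a) (hc : Γᶜ.Adj b c)
    (hac : a ≠ c) : geodesicGrowthRate (racgGenerators Γ) = 1 ∨
      IsPerronNumber (geodesicGrowthRate (racgGenerators Γ)) := by
  classical
  obtain ⟨k, hk⟩ := exists_transitionMatrix_pow_pos ha hc hac
  have : Nonempty {s // Full Γ s} := (exists_full Γ).elim fun s hs => ⟨⟨s, hs⟩⟩
  obtain ⟨r, x, hx, hr, hr1, hperron⟩ :=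
    Matrix.exists_pos_eigenvector_isPerronNumber (transitionMatrix Γ) (fun s => by
      obtain ⟨v, hv⟩ := s.2.exists_not_mem ha
      exact ⟨⟨_, s.2.step hv⟩, Finset.card_ne_zero.2 ⟨v, by simpa using hv⟩⟩) hk
  rw [geodesicGrowthRate_eq (h := fun s => if hs : Full Γ s then x ⟨s, hs⟩ else 0) (r := r)
    (fun s hs => by simpa [hs] using hx ⟨s, hs⟩) hr1 fun s hs => ?_]
  · exact hperron
  · have h1 := congrFun hr ⟨s, hs⟩
    rw [Pi.smul_apply, smul_eq_mul] at h1
    rw [dif_pos hs, ← h1]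
    set f : Finset V → ℝ := fun s => if hs : Full Γ s then x ⟨s, hs⟩ else 0 with hf
    calc ∑ v ∈ sᶜ, f (step Γ s v)
        = ∑ t, ∑ v ∈ sᶜ with step Γ s v = t, f (step Γ s v) :=
          (Finset.sum_fiberwise _ _ _).symm
      _ = ∑ t, ((sᶜ.filter fun v => step Γ s v = t).card : ℝ) * f t := by
          refine Finset.sum_congr rfl fun t _ => ?_
          rw [← nsmul_eq_mul, ← Finset.sum_const]
          exact Finset.sum_congr rfl fun v hv => by rw [(Finset.mem_filter.1 hv).2]
      _ = ∑ t with Full Γ t, ((sᶜ.filter fun v => step Γ s v = t).card : ℝ) * f t := by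
          refine (Finset.sum_filter_of_ne fun t _ ht => ?_).symm
          by_contra hfull
          exact ht (by rw [hf]; simp [hfull])
      _ = ∑ t : {t // Full Γ t}, ((sᶜ.filter fun v => step Γ s v = t.1).card : ℝ) * f t.1 :=
          Finset.sum_subtype _ (by simp) _
      _ = _ := Finset.sum_congr rfl fun t _ => by
          rw [hf]
          simp [transitionMatrix, t.2]

omit [DecidableRel Γ.Adj] [Fintype V] in
lemma Full.card_eq (hdeg : ∀ a b c, Γᶜ.Adj b a → Γᶜ.Adj b c → a = c) {s : Finset V}
    (hs : Full Γ s) : s.card = Nat.card Γᶜ.ConnectedComponent := by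
  rw [← Fintype.card_coe, ← Nat.card_eq_fintype_card]
  refine Nat.card_eq_of_bijective (fun a : s => Γᶜ.connectedComponentMk a.1) ⟨?_, fun C => ?_⟩
  · intro a b hab
    by_contra hne
    rcases (SimpleGraph.ConnectedComponent.exact hab).eq_or_adj hdeg with h | h
    · exact hne (Subtype.ext h)
    · exact ((SimpleGraph.compl_adj _ _ _).1 h).2 (hs.1 a a.2 b b.2 h.ne)
  · induction C using SimpleGraph.ConnectedComponent.ind with
    | h v =>
      obtain ⟨a, ha, hav⟩ := hs.2 v
      exact ⟨⟨a, ha⟩, SimpleGraph.ConnectedComponent.sound hav⟩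

lemma growth_of_degree_le_one (hdeg : ∀ a b c, Γᶜ.Adj b a → Γᶜ.Adj b c → a = c) {a b : V}
    (hab : Γᶜ.Adj a b) : geodesicGrowthRate (racgGenerators Γ) = 1 ∨
      IsPerronNumber (geodesicGrowthRate (racgGenerators Γ)) := by
  obtain ⟨m, hm⟩ : ∃ m : ℕ, ∀ s, Full Γ s → sᶜ.card = m :=
    ⟨_, fun s hs => by rw [Finset.card_compl, hs.card_eq hdeg]⟩
  have hm1 : 1 ≤ m := by
    obtain ⟨s, hs⟩ := exists_full Γ
    obtain ⟨v, hv⟩ := hs.exists_not_mem hab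
    rw [← hm s hs]
    exact Finset.card_pos.2 ⟨v, Finset.mem_compl.2 hv⟩
  rw [geodesicGrowthRate_eq (h := fun _ => 1) (r := m) (fun _ _ => zero_lt_one)
    (by exact_mod_cast hm1) fun s hs => by simp [← hm s hs]]
  rcases hm1.eq_or_lt with rfl | hm1
  · exact Or.inl Nat.cast_one
  · refine Or.inr ⟨isIntegral_algebraMap (x := (m : ℤ)), by exact_mod_cast hm1, fun z hz hne => ?_⟩
    refine absurd ?_ hne
    have := (isConjRoot_iff_eq_algebraMap' (K := ℚ) (r := (m : ℚ)) (x := z)).1 (by simpa using hz.symm)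
    simpa using this

omit [DecidableEq V] [DecidableRel Γ.Adj] in
lemma exists_compl_adj_of_infinite [Infinite (RACG Γ)] : ∃ a b, Γᶜ.Adj a b := by
  classical
  by_contra! h
  have hadj : ∀ a b, a ≠ b → Γ.Adj a b := fun a b hab =>
    by_contra fun hn => h a b (compl_adj_of_not_adj hab hn)
  have hall : ∀ (w : List V) v, Allows Γ v w → v ∉ w := by
    intro w
    induction w with
    | nil => simp
    | cons x w ih =>
      intro v hv
      rw [List.mem_cons, not_or]
      exact ⟨hv.1.symm, ih v (hv.2 (hadj _ _ hv.1))⟩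
  have hnodup : ∀ w : List V, Reduced Γ w → w.Nodup := by
    intro w
    induction w with
    | nil => simp
    | cons x w ih => exact fun hw => List.nodup_cons.2 ⟨hall w x hw.1, ih hw.2⟩
  have hsurj : Function.Surjective fun w : {w : List V // w.Nodup} => wordProd Γ w.1 := by
    intro g
    obtain ⟨w, hw, rfl⟩ := exists_reduced g
    exact ⟨⟨w, hnodup w hw⟩, rfl⟩
  have := Finite.of_surjective _ hsurj
  exact not_finite (RACG Γ)

end RACG

theorem theoremB {V : Type*} [Finite V] (Γ : SimpleGraph V) (hinf : Infinite (RACG Γ)) :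
    geodesicGrowthRate (racgGenerators Γ) = 1 ∨
      IsPerronNumber (geodesicGrowthRate (racgGenerators Γ)) := by
  classical
  cases nonempty_fintype V
  obtain ⟨a, b, hab⟩ := RACG.exists_compl_adj_of_infinite (Γ := Γ)
  by_cases h : ∀ a b c, Γᶜ.Adj b a → Γᶜ.Adj b c → a = c
  · exact RACG.growth_of_degree_le_one h hab
  · push Not at h
    obtain ⟨a, b, c, ha, hc, hac⟩ := h
    exact RACG.growth_of_primitive ha hc hac
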